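/- Let $k$ be a field of characteristic $0$ and let $L$ be a finite-dimensional (left or right) Leibniz algebra over $k$, i.e. a finite-dimensional $k$-vector space with a bilinear bracket $[\cdot,\cdot]$ such that either every left multiplication is a derivation, $[x,[y,z]]=[[x,y],z]+[y,[x,z]]$ for all $x,y,z\in L$, or every right multiplication is a derivation, $[[x,y],z]=[[x,z],y]+[x,[y,z]]$ for all $x,y,z\in L$. Let $R$ be the radical of $L$, i.e. its largest solvable two-sided ideal, where an ideal is solvable if its derived series reaches $0$. Then there is a subalgebra $S\subseteq L$ which, with the bracket of $L$, is a semisimple Lie algebra (possibly $0$), such that $L=S+R$. -/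

import Mathlib

/-! The bracket `[x, y]` of a (possibly non-Lie) algebra is written as the multiplication `x * y`
of a non-unital, non-associative algebra. -/

namespace Leibniz

section Identities

variable (A : Type*) [NonUnitalNonAssocRing A]

/-- Left Leibniz identity: every left multiplication is a derivation,
`[x, [y, z]] = [[x, y], z] + [y, [x, z]]`. -/
def IsLeftLeibniz : Prop :=
  ∀ x y z : A, x * (y * z) = (x * y) * z + y * (x * z)

/-- Right Leibniz identity: every right multiplication is a derivation,
`[[x, y], z] = [[x, z], y] + [x, [y, z]]`. -/
def IsRightLeibniz : Prop :=
  ∀ x y z : A, (x * y) * z = (x * z) * y + x * (y * z)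

/-- A Leibniz algebra, left or right. -/
def IsLeibniz : Prop :=
  IsLeftLeibniz A ∨ IsRightLeibniz A

/-- The multiplication is a Lie bracket: it is alternating and satisfies the Jacobi identity. -/
structure IsLie : Prop where
  mul_self : ∀ x : A, x * x = 0
  jacobi : ∀ x y z : A, x * (y * z) = (x * y) * z + y * (x * z)

end Identities

section Lie

variable {A : Type*} [NonUnitalNonAssocRing A]

/-- The Lie ring structure whose bracket is the given multiplication. -/
abbrev IsLie.lieRing (h : IsLie A) : LieRing A where
  bracket x y := x * y
  add_lie x y z := add_mul x y z
  lie_add x y z := mul_add x y z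
  lie_self x := h.mul_self x
  leibniz_lie x y z := h.jacobi x y z

/-- The Lie algebra structure whose bracket is the given multiplication. -/
abbrev IsLie.lieAlgebra (k : Type*) [Field k] [Module k A] [SMulCommClass k A A]
    (h : IsLie A) : letI := h.lieRing; LieAlgebra k A :=
  letI := h.lieRing
  { lie_smul := fun t x y => mul_smul_comm t x y }

end Lie

/-- `A` is a semisimple Lie algebra over `k`: its multiplication is a Lie bracket, and the Lie
algebra so obtained is semisimple. (The zero algebra is semisimple.) -/
def IsSemisimpleLie (k A : Type*) [Field k] [NonUnitalNonAssocRing A] [Module k A]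
    [SMulCommClass k A A] : Prop :=
  ∃ h : IsLie A,
    letI := h.lieRing
    letI := h.lieAlgebra k
    LieAlgebra.IsSemisimple k A

section Radical

variable {k L : Type*} [Field k] [NonUnitalNonAssocRing L] [Module k L]
  [IsScalarTower k L L] [SMulCommClass k L L]

/-- A two-sided ideal. -/
def IsIdeal (I : Submodule k L) : Prop :=
  ∀ x : L, ∀ y ∈ I, x * y ∈ I ∧ y * x ∈ I

/-- The derived series of a subspace `I`: it starts with `I`, and each further member is the span
of the products of two elements of the previous one. -/
def derivedSeries (I : Submodule k L) : ℕ → Submodule k L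
  | 0 => I
  | n + 1 => Submodule.map₂ (LinearMap.mul k L) (derivedSeries I n) (derivedSeries I n)

/-- The derived series reaches zero. -/
def IsSolvable (I : Submodule k L) : Prop :=
  ∃ n : ℕ, derivedSeries I n = ⊥

variable (k L) in
/-- The solvable radical: the sum of all solvable two-sided ideals. When `L` is finite-dimensional
it is the largest solvable ideal, see `isGreatest_radical`. -/
def radical : Submodule k L :=
  sSup {I : Submodule k L | IsIdeal I ∧ IsSolvable I}

theorem derivedSeries_sup_le (I J : Submodule k L) (hJ : IsIdeal J) (n : ℕ) :
    derivedSeries (I ⊔ J) n ≤ derivedSeries I n ⊔ J := by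
  induction n with
  | zero => exact le_rfl
  | succ n ih =>
    refine Submodule.map₂_le.2 fun x hx y hy => ?_
    obtain ⟨a, ha, b, hb, rfl⟩ := Submodule.mem_sup.1 (ih hx)
    obtain ⟨c, hc, d, hd, rfl⟩ := Submodule.mem_sup.1 (ih hy)
    refine Submodule.mem_sup.2 ⟨a * c, Submodule.apply_mem_map₂ _ ha hc, a * d + b * (c + d),
      J.add_mem (hJ a d hd).1 (hJ (c + d) b hb).2, ?_⟩
    simp only [LinearMap.mul_apply', add_mul, mul_add]
    abel

theorem derivedSeries_mono {I J : Submodule k L} (h : I ≤ J) (n : ℕ) :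
    derivedSeries I n ≤ derivedSeries J n := by
  induction n with
  | zero => exact h
  | succ n ih => exact Submodule.map₂_le_map₂ ih ih

theorem derivedSeries_add (I : Submodule k L) (m n : ℕ) :
    derivedSeries I (m + n) = derivedSeries (derivedSeries I m) n := by
  induction n with
  | zero => rfl
  | succ n ih => rw [← add_assoc, derivedSeries, derivedSeries, ih]

theorem IsIdeal.sup {I J : Submodule k L} (hI : IsIdeal I) (hJ : IsIdeal J) :
    IsIdeal (I ⊔ J) := by
  intro x y hy
  obtain ⟨a, ha, b, hb, rfl⟩ := Submodule.mem_sup.1 hy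
  rw [mul_add, add_mul]
  exact ⟨Submodule.add_mem_sup (hI x a ha).1 (hJ x b hb).1,
    Submodule.add_mem_sup (hI x a ha).2 (hJ x b hb).2⟩

theorem IsSolvable.sup {I J : Submodule k L} (hI : IsSolvable I) (hJ : IsIdeal J)
    (hJ' : IsSolvable J) : IsSolvable (I ⊔ J) := by
  obtain ⟨m, hm⟩ := hI
  obtain ⟨n, hn⟩ := hJ'
  refine ⟨m + n, ?_⟩
  have h := derivedSeries_sup_le I J hJ m
  rw [hm, bot_sup_eq] at h
  rw [derivedSeries_add, eq_bot_iff, ← hn]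
  exact derivedSeries_mono h n

variable (k L) in
/-- The radical of a finite-dimensional algebra is its largest solvable two-sided ideal. -/
theorem isGreatest_radical [FiniteDimensional k L] :
    IsGreatest {I : Submodule k L | IsIdeal I ∧ IsSolvable I} (radical k L) := by
  refine ⟨?_, fun I hI => le_sSup hI⟩
  refine CompleteLattice.WellFoundedGT.isSupClosedCompact (Submodule k L) inferInstance
    {I : Submodule k L | IsIdeal I ∧ IsSolvable I} ⟨⊥, ?_, 0, rfl⟩ ?_
  · intro x y hy
    rw [Submodule.mem_bot] at hy
    simp [hy]
  · rintro I ⟨hI, hI'⟩ J ⟨hJ, hJ'⟩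
    exact ⟨hI.sup hJ, hI'.sup hJ hJ'⟩

end Radical

end Leibniz

/-! Passing to the opposite algebra turns a right Leibniz algebra into a left one, so let `L` be
left Leibniz. Squares span a solvable ideal, so they lie in the radical `R`, and `g = L/R` is a Lie
algebra without nonzero abelian ideals; in characteristic zero its Killing form is then
nondegenerate (`IsKilling`). It remains to split `L → g`.

A linear section is improved along the derived series of `R` (`exists_correction`). If `σ` is
multiplicative modulo the `n`-th term, its defect `σ x * σ y - σ ⁅x, y⁆` is a Leibniz 2-cocycle of
`g` with values in the quotient of the `n`-th term by the next, a Leibniz bimodule. Writing it as a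
coboundary makes `σ` multiplicative modulo the next term, and solvability ends the process.

The cocycle is a coboundary by `exists_leibniz_coboundary`, which needs only Whitehead's first
lemma, applied twice to modules built from `Hom(g, M)`. Whitehead's lemma is proved with a Casimir
operator and induction on dimension. -/

open LieAlgebra LieModule Module

/-! ### Invariant tensors from dual bases -/

section Invariant

variable {k V W ι : Type*} [Field k] [AddCommGroup V] [Module k V] [AddCommGroup W] [Module k W]
  [Fintype ι] [DecidableEq ι]

/-- If `T` is skew-adjoint for a nondegenerate symmetric form, then the tensor defined by a pair of
dual bases is annihilated by `T`. -/
theorem sum_apply_dualBasis_add_eq_zero [FiniteDimensional k V] (B : LinearMap.BilinForm k V)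
    (hB : B.Nondegenerate) (hs : B.IsSymm) (b : Basis ι k V) (T : V →ₗ[k] V)
    (hT : ∀ x y, B (T x) y + B x (T y) = 0) (F : V →ₗ[k] V →ₗ[k] W) :
    ∑ i, (F (T (b i)) (B.dualBasis hB b i) + F (b i) (T (B.dualBasis hB b i))) = 0 := by
  have h₁ (x : V) : x = ∑ j, B x (B.dualBasis hB b j) • b j := by
    conv_lhs => rw [← b.sum_repr x]
    refine Finset.sum_congr rfl fun j _ => ?_
    congr 1
    conv_rhs => rw [← b.sum_repr x]
    simp [-Basis.sum_repr, LinearMap.BilinForm.apply_dualBasis_right, hs]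
  have h₂ (x : V) : x = ∑ j, B x (b j) • B.dualBasis hB b j := by
    conv_lhs => rw [← (B.dualBasis hB b).sum_repr x]
    simp
  have h₃ : ∑ i, F (T (b i)) (B.dualBasis hB b i) =
      ∑ i, ∑ j, B (T (b i)) (B.dualBasis hB b j) • F (b j) (B.dualBasis hB b i) :=
    Finset.sum_congr rfl fun i _ => by conv_lhs => rw [h₁ (T (b i))]
                                       simp
  have h₄ : ∑ i, F (b i) (T (B.dualBasis hB b i)) =
      ∑ i, ∑ j, B (T (B.dualBasis hB b j)) (b i) • F (b j) (B.dualBasis hB b i) := by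
    rw [Finset.sum_comm]
    exact Finset.sum_congr rfl fun i _ => by conv_lhs => rw [h₂ (T (B.dualBasis hB b i))]
                                             simp
  -- Both sums are now expanded in the terms `F (b j) (b* i)`, where `b*` is the dual basis; the two
  -- coefficients cancel by skewness of `T` and symmetry of `B`.
  rw [Finset.sum_add_distrib, h₃, h₄, ← Finset.sum_add_distrib]
  refine Finset.sum_eq_zero fun i _ => ?_
  rw [← Finset.sum_add_distrib]
  refine Finset.sum_eq_zero fun j _ => ?_
  rw [← add_smul, ← hs.eq (b i) (T (B.dualBasis hB b j)), hT, zero_smul]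

end Invariant

/-! ### Casimir operators and Whitehead's first lemma -/

section Whitehead

/-- The action of a Lie algebra on a module as a bilinear map. -/
def LieModule.action (k g M : Type*) [Field k] [LieRing g] [LieAlgebra k g] [AddCommGroup M]
    [Module k M] [LieRingModule g M] [LieModule k g M] : g →ₗ[k] M →ₗ[k] M :=
  LinearMap.mk₂ k (fun x m => ⁅x, m⁆) add_lie (fun t x m => smul_lie t x m) lie_add
    (fun t x m => lie_smul t x m)

@[simp] theorem LieModule.action_apply {k g M : Type*} [Field k] [LieRing g] [LieAlgebra k g]
    [AddCommGroup M] [Module k M] [LieRingModule g M] [LieModule k g M] (x : g) (m : M) :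
    action k g M x m = ⁅x, m⁆ := rfl

variable {k g : Type*} [Field k] [CharZero k] [LieRing g] [LieAlgebra k g] [FiniteDimensional k g]
  [IsKilling k g]

-- The Killing complement of `D = [g, g]` has its brackets both in `D` and in itself, so it is an
-- abelian ideal, hence zero.
omit [CharZero k] in
variable (k g) in
theorem LieAlgebra.IsKilling.derivedSeries_one_eq_top : derivedSeries k g 1 = ⊤ := by
  set D := derivedSeries k g 1 with hD
  have hc := D.isCompl_killingCompl
  have : IsLieAbelian D.killingCompl := by
    rw [LieSubmodule.lie_abelian_iff_lie_self_eq_bot, eq_bot_iff, ← hc.inf_eq_bot]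
    refine le_inf ?_ (LieSubmodule.lie_le_right _ _)
    rw [hD]
    exact LieSubmodule.mono_lie le_top le_top
  rw [IsKilling.ideal_eq_bot_of_isLieAbelian D.killingCompl] at hc
  simpa using hc.sup_eq_top

omit [CharZero k] in
/-- A nilpotent module over a perfect Lie algebra is trivial. -/
theorem LieModule.isTrivial_of_isNilpotent_of_isKilling (M : Type*) [AddCommGroup M] [Module k M]
    [LieRingModule g M] [LieModule k g M] (h : IsNilpotent g M) : IsTrivial g M := by
  have htop : ⁅(⊤ : LieIdeal k g), (⊤ : LieIdeal k g)⁆ = ⊤ :=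
    IsKilling.derivedSeries_one_eq_top k g
  -- Since `g = [g, g]`, Jacobi gives `[g, N] ⊆ [g, [g, N]]`: the lower central series is constant
  -- from its first term on.
  have key (N : LieSubmodule k g M) :
      ⁅(⊤ : LieIdeal k g), N⁆ ≤ ⁅(⊤ : LieIdeal k g), ⁅(⊤ : LieIdeal k g), N⁆⁆ := by
    have : ⁅⁅(⊤ : LieIdeal k g), (⊤ : LieIdeal k g)⁆, N⁆ ≤
        ⁅(⊤ : LieIdeal k g), ⁅(⊤ : LieIdeal k g), N⁆⁆ := by
      refine (LieSubmodule.lie_le_iff _ _ _).2 fun x hx m hm => ?_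
      rw [← LieSubmodule.mem_toSubmodule, LieSubmodule.lieIdeal_oper_eq_linear_span'] at hx
      induction hx using Submodule.span_induction with
      | mem x hx =>
        obtain ⟨a, ha, b, hb, rfl⟩ := hx
        rw [lie_lie]
        exact sub_mem (LieSubmodule.lie_mem_lie ha (LieSubmodule.lie_mem_lie hb hm))
          (LieSubmodule.lie_mem_lie hb (LieSubmodule.lie_mem_lie ha hm))
      | zero => simp
      | add x y _ _ hx hy => rw [add_lie]; exact add_mem hx hy
      | smul t x _ hx => rw [smul_lie]; exact Submodule.smul_mem _ t hx
    rwa [htop] at this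
  have hlcs (n : ℕ) : lowerCentralSeries k g M 1 ≤ lowerCentralSeries k g M (n + 1) := by
    induction n with
    | zero => exact le_rfl
    | succ n ih =>
      refine ih.trans ?_
      rw [lowerCentralSeries_succ, lowerCentralSeries_succ k g M (n + 1),
        lowerCentralSeries_succ]
      exact key _
  obtain ⟨n, hn⟩ := (isNilpotent_iff k g M).1 h
  refine ⟨fun x m => ?_⟩
  have h₁ : ⁅x, m⁆ ∈ lowerCentralSeries k g M 1 := by
    rw [lowerCentralSeries_succ]
    exact LieSubmodule.lie_mem_lie (LieSubmodule.mem_top x) (LieSubmodule.mem_top m)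
  have h₂ := antitone_lowerCentralSeries k g M (Nat.le_succ n) (hlcs n h₁)
  rwa [hn, LieSubmodule.mem_bot] at h₂

/-- A vanishing trace form makes the derived algebra act nilpotently; here that algebra is all of
`g`, and Engel's theorem makes the module nilpotent. -/
theorem LieModule.isTrivial_of_traceForm_eq_zero (M : Type*) [AddCommGroup M] [Module k M]
    [LieRingModule g M] [LieModule k g M] [FiniteDimensional k M] (h : traceForm k g M = 0) :
    IsTrivial g M := by
  refine isTrivial_of_isNilpotent_of_isKilling (k := k) M ?_
  have hn := isNilpotent_derivedSeries_of_traceForm_eq_zero (R := k) h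
  rw [isNilpotent_iff_forall' (R := k)] at hn ⊢
  exact fun x => hn ⟨x, by rw [IsKilling.derivedSeries_one_eq_top]; trivial⟩

/-- A nontrivial finite-dimensional module of a semisimple Lie algebra has an invariant tensor
whose Casimir operator has nonzero trace. -/
theorem LieModule.exists_casimir (M : Type*) [AddCommGroup M] [Module k M]
    [LieRingModule g M] [LieModule k g M] [FiniteDimensional k M] (h : traceForm k g M ≠ 0) :
    ∃ (n : ℕ) (a b : Fin n → g),
      (∀ (F : g →ₗ[k] g →ₗ[k] M) (x : g), ∑ i, (F ⁅x, a i⁆ (b i) + F (a i) ⁅x, b i⁆) = 0) ∧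
      ∑ i, traceForm k g M (a i) (b i) ≠ 0 := by
  -- The trace form may be degenerate. It becomes nondegenerate on the Killing complement `J` of its
  -- kernel `I`, and dual bases of `J` give the tensor.
  let I : LieIdeal k g := 
    { LinearMap.ker (traceForm k g M) with
      lie_mem := fun {x m} hm => by
        change traceForm k g M _ = 0
        ext z
        rw [traceForm_apply_lie_apply', show traceForm k g M m = 0 from hm]
        simp }
  let J := I.killingCompl
  have hIJ : IsCompl I J := I.isCompl_killingCompl
  have hI (x : g) : x ∈ I ↔ ∀ y, traceForm k g M x y = 0 := by
    change traceForm k g M x = 0 ↔ _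
    rw [LinearMap.ext_iff]; rfl
  let B : LinearMap.BilinForm k J := (traceForm k g M).restrict J.toSubmodule
  have hs : B.IsSymm := ⟨fun x y => traceForm_comm k g M x y⟩
  have hB : B.Nondegenerate := by
    refine hs.isRefl.nondegenerate_iff_separatingLeft.mpr fun x hx => ?_
    have hxI : (x : g) ∈ I := by
      rw [hI]
      intro y
      obtain ⟨u, hu, v, hv, rfl⟩ := (LieSubmodule.mem_sup I J y).1 (by rw [hIJ.sup_eq_top]; trivial)
      rw [map_add, traceForm_comm, (hI u).1 hu, zero_add]
      exact hx ⟨v, hv⟩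
    have : (x : g) ∈ I ⊓ J := ⟨hxI, x.2⟩
    rw [hIJ.inf_eq_bot, LieSubmodule.mem_bot] at this
    exact Subtype.ext this
  let e := finBasis k J
  refine ⟨_, fun i => e i, fun i => B.dualBasis hB e i, fun F x => ?_, ?_⟩
  · exact sum_apply_dualBasis_add_eq_zero B hB hs e (toEnd k g J x)
      (fun y z => by
        change traceForm k g M ⁅x, (y : g)⁆ z + traceForm k g M y ⁅x, (z : g)⁆ = 0
        rw [traceForm_apply_lie_apply']; simp)
      (F.compl₁₂ J.toSubmodule.subtype J.toSubmodule.subtype)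
  -- The trace is `dim J`, nonzero in characteristic zero unless `J = 0`, that is, unless the trace
  -- form vanishes.
  · have h₁ (i) : traceForm k g M (e i) (B.dualBasis hB e i) = 1 := by
      have := LinearMap.BilinForm.apply_dualBasis_right hB hs e i i
      rw [if_pos rfl] at this
      exact this
    simp only [h₁, Finset.sum_const, Finset.card_univ, Fintype.card_fin, nsmul_eq_mul, mul_one]
    rw [Nat.cast_ne_zero]
    intro h0
    apply h
    have hJ : J.toSubmodule = ⊥ := Submodule.finrank_eq_zero.1 h0
    rw [LieSubmodule.toSubmodule_eq_bot] at hJ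
    rw [hJ] at hIJ
    have hIt : I = ⊤ := by simpa using hIJ.sup_eq_top
    ext x y
    exact (hI x).1 (by rw [hIt]; trivial) y

-- Exactness of `H¹(g, N) → H¹(g, M) → H¹(g, M/N)` in the middle: subtract an inner derivation found
-- modulo `N`, then treat the remainder inside `N`.
omit [CharZero k] [FiniteDimensional k g] [IsKilling k g] in
theorem LieModule.exists_eq_lie_of_submodule {M : Type*} [AddCommGroup M] [Module k M]
    [LieRingModule g M] [LieModule k g M] (N : LieSubmodule k g M)
    (hN : ∀ d : g →ₗ[k] N, (∀ x y, d ⁅x, y⁆ = ⁅x, d y⁆ - ⁅y, d x⁆) → ∃ m, ∀ x, d x = ⁅x, m⁆)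
    (hQ : ∀ d : g →ₗ[k] M ⧸ N, (∀ x y, d ⁅x, y⁆ = ⁅x, d y⁆ - ⁅y, d x⁆) → ∃ m, ∀ x, d x = ⁅x, m⁆)
    (d : g →ₗ[k] M) (hd : ∀ x y, d ⁅x, y⁆ = ⁅x, d y⁆ - ⁅y, d x⁆) : ∃ m, ∀ x, d x = ⁅x, m⁆ := by
  obtain ⟨m', hm'⟩ := hQ ((LieSubmodule.Quotient.mk' N).toLinearMap ∘ₗ d) (fun x y => by
    change Submodule.Quotient.mk _ = _
    rw [hd]
    rfl)
  obtain ⟨m, rfl⟩ := LieSubmodule.Quotient.surjective_mk' N m'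
  have hmem (x : g) : d x - ⁅x, m⁆ ∈ N := by
    rw [← LieSubmodule.Quotient.mk_eq_zero']
    exact sub_eq_zero.2 (hm' x)
  let d' : g →ₗ[k] N :=
    { toFun x := ⟨d x - ⁅x, m⁆, hmem x⟩
      map_add' x y := Subtype.ext <| by
        simp only [map_add, add_lie, LieSubmodule.coe_add]
        abel
      map_smul' t x := Subtype.ext <| by simp [smul_sub] }
  obtain ⟨n, hn⟩ := hN d' fun x y => Subtype.ext <| by
    simp only [d', LinearMap.coe_mk, AddHom.coe_mk, LieSubmodule.coe_sub,
      LieSubmodule.coe_bracket, hd, lie_lie, lie_sub]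
    abel
  exact ⟨m + n, fun x => by rw [lie_add, ← sub_eq_iff_eq_add']; exact congrArg Subtype.val (hn x)⟩

/-- **Whitehead's first lemma**: every derivation of a semisimple Lie algebra of characteristic zero
into a finite-dimensional module is inner. -/
theorem LieModule.exists_eq_lie_of_isKilling {M : Type*} [AddCommGroup M] [Module k M]
    [LieRingModule g M] [LieModule k g M] [FiniteDimensional k M]
    (d : g →ₗ[k] M) (hd : ∀ x y, d ⁅x, y⁆ = ⁅x, d y⁆ - ⁅y, d x⁆) : ∃ m, ∀ x, d x = ⁅x, m⁆ := by
  induction hn : finrank k M using Nat.strong_induction_on generalizing M with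
  | _ n ih =>
  by_cases h : traceForm k g M = 0
  -- On a trivial module a derivation kills all brackets, and these span `g`.
  · have := isTrivial_of_traceForm_eq_zero M h
    refine ⟨0, fun x => ?_⟩
    have hx : x ∈ (derivedSeries k g 1).toSubmodule := by
      rw [IsKilling.derivedSeries_one_eq_top]; trivial
    rw [derivedSeries_def, derivedSeriesOfIdeal_succ,
      LieSubmodule.lieIdeal_oper_eq_linear_span'] at hx
    rw [lie_zero]
    induction hx using Submodule.span_induction with
    | mem x hx =>
      obtain ⟨a, ha, b, hb, rfl⟩ := hx
      rw [hd, this.trivial, this.trivial, sub_zero]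
    | zero => simp
    | add x y _ _ hx hy => rw [map_add, hx, hy, add_zero]
    | smul t x _ hx => rw [map_smul, hx, smul_zero]
  · obtain ⟨p, a, b, hinv, htr⟩ := exists_casimir M h
    let Ω : M →ₗ[k] M := ∑ i, toEnd k g M (a i) ∘ₗ toEnd k g M (b i)
    have hΩ (m : M) : Ω m = ∑ i, ⁅a i, ⁅b i, m⁆⁆ := by simp [Ω]
    have hcomm (x : g) (m : M) : Ω ⁅x, m⁆ = ⁅x, Ω m⁆ := by
      have h := hinv ((action k g M).compl₂ ((action k g M).flip m)) x
      rw [hΩ, hΩ, lie_sum, ← sub_eq_zero, ← Finset.sum_sub_distrib, ← neg_eq_zero,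
        ← Finset.sum_neg_distrib, ← h]
      refine Finset.sum_congr rfl fun i _ => ?_
      simp only [LinearMap.compl₂_apply, LinearMap.flip_apply, action_apply, lie_lie, lie_sub]
      abel
    have hΩ0 : Ω ≠ 0 := by
      intro h0
      apply htr
      have := congrArg (LinearMap.trace k M) h0
      simpa [Ω, traceForm_apply_apply] using this
    by_cases hinj : LinearMap.ker Ω = ⊥
    -- Invariance of the tensor applied to `F a b = ⁅a, d b⁆`. Since `Ω` is bijective and commutes
    -- with `g`, the element sought is `Ω⁻¹ (∑ i, ⁅a i, d (b i)⁆)`.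
    · have h (x : g) : Ω (d x) = ⁅x, ∑ i, ⁅a i, d (b i)⁆⁆ := by
        have h := hinv ((action k g M).compl₂ d) x
        rw [hΩ, lie_sum, eq_comm, ← sub_eq_zero, ← Finset.sum_sub_distrib, ← h]
        refine Finset.sum_congr rfl fun i _ => ?_
        simp only [LinearMap.compl₂_apply, action_apply, lie_lie, lie_sub, hd]
        abel
      obtain ⟨m, hm⟩ := (LinearMap.injective_iff_surjective.1 (LinearMap.ker_eq_bot.1 hinj))
        (∑ i, ⁅a i, d (b i)⁆)
      refine ⟨m, fun x => LinearMap.ker_eq_bot.1 hinj ?_⟩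
      rw [h, hcomm, hm]
    -- Here `ker Ω` is a nonzero proper submodule, so induction applies to it and to its quotient.
    · let N : LieSubmodule k g M :=
        { LinearMap.ker Ω with
          lie_mem := fun {x m} hm => by
            change Ω _ = 0
            rw [hcomm, show Ω m = 0 from hm, lie_zero] }
      refine exists_eq_lie_of_submodule N (fun d hd => ih _ ?_ d hd rfl)
        (fun d hd => ih _ ?_ d hd rfl) d hd
      · rw [← hn]
        exact Submodule.finrank_lt (s := LinearMap.ker Ω) (mt LinearMap.ker_eq_top.1 hΩ0)
      · rw [← hn]
        have := Submodule.finrank_quotient_add_finrank (LinearMap.ker Ω)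
        have h1 : 0 < finrank k (LinearMap.ker Ω) :=
          Nat.pos_of_ne_zero (mt Submodule.finrank_eq_zero.1 hinj)
        change finrank k (M ⧸ LinearMap.ker Ω) < _
        omega

end Whitehead

/-! ### Vanishing of second Leibniz cohomology -/

section Bimodule

variable {k g : Type*} [Field k] [CharZero k] [LieRing g] [LieAlgebra k g] [FiniteDimensional k g]
  [IsKilling k g]

/-- Leibniz cohomology of a semisimple Lie algebra vanishes in degree two: let `M` be a
finite-dimensional left Leibniz bimodule, with left action `⁅x, m⁆` and right action `r x m`. Then
every Leibniz `2`-cocycle with values in `M` is a coboundary. -/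
theorem LieModule.exists_leibniz_coboundary {M : Type*} [AddCommGroup M] [Module k M]
    [LieRingModule g M] [LieModule k g M] [FiniteDimensional k M] (r : g →ₗ[k] M →ₗ[k] M)
    (hr₁ : ∀ (x z : g) (m : M), r ⁅x, z⁆ m = ⁅x, r z m⁆ - r z ⁅x, m⁆)
    (hr₂ : ∀ (y z : g) (m : M), r ⁅y, z⁆ m = r z (r y m) + ⁅y, r z m⁆)
    (c : g →ₗ[k] g →ₗ[k] M)
    (hc : ∀ x y z, c x ⁅y, z⁆ + ⁅x, c y z⁆ = c ⁅x, y⁆ z + r z (c x y) + c y ⁅x, z⁆ + ⁅y, c x z⁆) :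
    ∃ h : g →ₗ[k] M, ∀ x y, c x y = ⁅x, h y⁆ + r y (h x) - h ⁅x, y⁆ := by
  have hrr (y z : g) (m : M) : r z (r y m) = - r z ⁅y, m⁆ := by
    have := (hr₁ y z m).symm.trans (hr₂ y z m)
    rw [sub_eq_add_neg, add_comm] at this
    exact (add_right_cancel this).symm
  -- As a map `g → Hom(g, M)`, `c` fails to be a derivation only by the term `r z (c x y)`, which
  -- lies in `P` as a function of `z`. Whitehead's lemma thus applies modulo `P`.
  let P : LieSubmodule k g (g →ₗ[k] M) :=
    { LinearMap.range r.flip with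
      lie_mem := by
        rintro x _ ⟨m, rfl⟩
        refine ⟨⁅x, m⁆, ?_⟩
        ext z
        simp [hr₁] }
  obtain ⟨H', hH'⟩ := exists_eq_lie_of_isKilling ((LieSubmodule.Quotient.mk' P).toLinearMap ∘ₗ c)
    (fun x y => by
      refine (Submodule.Quotient.eq P.toSubmodule (x := c ⁅x, y⁆)
        (y := ⁅x, c y⁆ - ⁅y, c x⁆)).2 ⟨- c x y, ?_⟩
      ext z
      simp only [map_neg, LinearMap.flip_apply, LinearMap.sub_apply, LinearMap.neg_apply,
        LieHom.lie_apply]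
      linear_combination (norm := module) hc x y z)
  obtain ⟨H, rfl⟩ := LieSubmodule.Quotient.surjective_mk' P H'
  have hmem (x : g) : (c - (action k g (g →ₗ[k] M)).flip H) x ∈ LinearMap.range r.flip :=
    (Submodule.Quotient.eq P.toSubmodule).1 (hH' x)
  obtain ⟨s, hs⟩ := r.flip.rangeRestrict.exists_rightInverse_of_surjective
    (LinearMap.range_rangeRestrict _)
  -- Subtracting `H` makes the remainder after the full coboundary of `H`, right action included,
  -- equal to `r z (t x)`.
  let t : g →ₗ[k] M := s ∘ₗ LinearMap.codRestrict _ _ hmem - H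
  have ht (x z : g) : c x z = ⁅x, H z⁆ + r z (H x) - H ⁅x, z⁆ + r z (t x) := by
    have h := congrArg Subtype.val (LinearMap.congr_fun hs (LinearMap.codRestrict _ _ hmem x))
    have h := LinearMap.congr_fun h z
    have h' : r z (s (LinearMap.codRestrict _ _ hmem x)) = c x z - (⁅x, H z⁆ - H ⁅x, z⁆) := h
    simp only [t, LinearMap.sub_apply, LinearMap.comp_apply, map_sub, h']
    abel
  have heq (x y z : g) : r z ⁅x, t y⁆ = r z (t ⁅x, y⁆) := by
    have h := hc x y z
    simp only [ht, lie_add, lie_sub, map_add, map_sub, hr₁, hrr, lie_lie] at h ⊢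
    linear_combination (norm := module) h
  -- By `heq`, every `⁅x, t⁆` takes values killed by the right action. So `x ↦ ⁅x, t⁆` is a
  -- derivation into `Q`, hence `⁅x, u⁆` with `u ∈ Q`. Then `t - u` is equivariant and its
  -- coboundary is `r z (t x)`.
  let Q : LieSubmodule k g (g →ₗ[k] M) :=
    { carrier := {f | ∀ y z, r z (f y) = 0}
      add_mem' := fun {f f'} hf hf' y z => by simp [hf y z, hf' y z]
      zero_mem' := fun y z => by simp
      smul_mem' := fun a f hf y z => by simp [hf y z]
      lie_mem := fun {x f} hf y z => by
        have h := hr₁ x z (f y)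
        rw [hf y, hf y, lie_zero, zero_sub, eq_comm, neg_eq_zero] at h
        rw [LieHom.lie_apply, map_sub, h, hf, sub_zero] }
  let d : g →ₗ[k] Q := LinearMap.codRestrict Q.toSubmodule ((action k g (g →ₗ[k] M)).flip t)
    (fun x y z => by
      rw [LinearMap.flip_apply, action_apply, LieHom.lie_apply, map_sub, heq, sub_self])
  obtain ⟨u, hu⟩ := exists_eq_lie_of_isKilling d (fun x y => Subtype.ext (lie_lie x y t))
  refine ⟨H + t - u, fun x z => ?_⟩
  have h := LinearMap.congr_fun (congrArg Subtype.val (hu x)) z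
  have h' : ⁅x, t z⁆ - t ⁅x, z⁆ = ⁅x, (u : g →ₗ[k] M) z⁆ - (u : g →ₗ[k] M) ⁅x, z⁆ := h
  have hu' : r z ((u : g →ₗ[k] M) x) = 0 := u.2 x z
  rw [ht]
  simp only [LinearMap.sub_apply, LinearMap.add_apply, lie_add, lie_sub, map_add, map_sub, hu']
  linear_combination (norm := module) -h'

end Bimodule

namespace Leibniz

/-! ### Correcting a section across one abelian layer -/

section Lifting

variable {k g L : Type*} [Field k] [CharZero k] [LieRing g] [LieAlgebra k g]
  [FiniteDimensional k g] [IsKilling k g]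
  [NonUnitalNonAssocRing L] [Module k L] [IsScalarTower k L L] [SMulCommClass k L L]
  [FiniteDimensional k L]

/-- A linear map that is multiplicative modulo an ideal `A` can be corrected by a map into `A` so
that it becomes multiplicative modulo an ideal `B ≤ A` containing all products of elements
of `A`. -/
theorem exists_correction (hL : IsLeftLeibniz L) {A B : Submodule k L} (hA : IsIdeal A)
    (hB : IsIdeal B) (hAB : ∀ a ∈ A, ∀ b ∈ A, a * b ∈ B) (σ : g →ₗ[k] L)
    (hσ : ∀ x y, σ x * σ y - σ ⁅x, y⁆ ∈ A) :
    ∃ h : g →ₗ[k] L, (∀ x, h x ∈ A) ∧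
      ∀ x y, (σ - h) x * (σ - h) y - (σ - h) ⁅x, y⁆ ∈ B := by
  let M := A ⧸ B.comap A.subtype
  let q : A →ₗ[k] M := (B.comap A.subtype).mkQ
  have hq (a b : A) : q a = q b ↔ (a - b : L) ∈ B := Submodule.Quotient.eq _
  have hq_surj : Function.Surjective q := Submodule.mkQ_surjective _
  let ind (T : g →ₗ[k] L →ₗ[k] L) (hTA : ∀ x, ∀ a ∈ A, T x a ∈ A) (hTB : ∀ x, ∀ a ∈ B, T x a ∈ B) :
      g →ₗ[k] M →ₗ[k] M :=
    { toFun x := (B.comap A.subtype).mapQ (B.comap A.subtype) ((T x).restrict (hTA x))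
        (fun a ha => hTB x a ha)
      map_add' x y := by
        ext a
        exact (hq ⟨_, hTA (x + y) a a.2⟩ (⟨_, hTA x a a.2⟩ + ⟨_, hTA y a a.2⟩)).2 (by simp)
      map_smul' t x := by
        ext a
        exact (hq ⟨_, hTA (t • x) a a.2⟩ (t • ⟨_, hTA x a a.2⟩)).2 (by simp) }
  let l : g →ₗ[k] M →ₗ[k] M := ind (LinearMap.mul k L ∘ₗ σ) (fun x a ha => (hA _ a ha).1)
    (fun x a ha => (hB _ a ha).1)
  let r : g →ₗ[k] M →ₗ[k] M := ind ((LinearMap.mul k L).flip ∘ₗ σ) (fun x a ha => (hA _ a ha).2)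
    (fun x a ha => (hB _ a ha).2)
  have hl (x : g) (a : A) : l x (q a) = q ⟨σ x * a, (hA _ a a.2).1⟩ := rfl
  have hr (x : g) (a : A) : r x (q a) = q ⟨a * σ x, (hA _ a a.2).2⟩ := rfl
  -- The action axioms hold on `M` because the defect of `σ` lies in `A` and products within `A`
  -- vanish modulo `B`.
  have hll (x y : g) (m : M) : l x (l y m) = l ⁅x, y⁆ m + l y (l x m) := by
    obtain ⟨a, rfl⟩ := hq_surj m
    rw [hl, hl, hl, hl, hl, ← map_add, hq]
    convert hAB _ (hσ x y) a a.2 using 1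
    simp only [Submodule.coe_add, hL (σ x), sub_mul]
    abel
  let : LieRingModule g M :=
    { bracket x m := l x m
      add_lie x y m := by simp only [map_add, LinearMap.add_apply]
      lie_add x m n := map_add _ m n
      leibniz_lie := hll }
  have hbr (x : g) (m : M) : ⁅x, m⁆ = l x m := rfl
  let : LieModule k g M :=
    { smul_lie t x m := by simp only [hbr, map_smul, LinearMap.smul_apply]
      lie_smul t x m := map_smul _ t m }
  let c : g →ₗ[k] g →ₗ[k] M := LinearMap.mk₂ k (fun x y => q ⟨σ x * σ y - σ ⁅x, y⁆, hσ x y⟩)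
    (fun x y z => by
      rw [← map_add, hq]
      convert B.zero_mem
      simp only [Submodule.coe_add, map_add, add_mul, add_lie]
      abel)
    (fun t x y => by
      rw [← map_smul, hq]
      convert B.zero_mem
      simp [smul_sub, smul_mul_assoc])
    (fun x y z => by
      rw [← map_add, hq]
      convert B.zero_mem
      simp only [Submodule.coe_add, map_add, mul_add, lie_add]
      abel)
    (fun t x y => by
      rw [← map_smul, hq]
      convert B.zero_mem
      simp [smul_sub, mul_smul_comm])
  have hcq (x y : g) : c x y = q ⟨σ x * σ y - σ ⁅x, y⁆, hσ x y⟩ := rfl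
  obtain ⟨h, hh⟩ := LieModule.exists_leibniz_coboundary (M := M) r
    (fun x z m => by
      obtain ⟨a, rfl⟩ := hq_surj m
      rw [hbr, hbr, hr, hl, hr, hl, hr, ← map_sub, hq]
      convert B.neg_mem (hAB a a.2 _ (hσ x z)) using 1
      simp only [Submodule.coe_sub, hL (σ x), mul_sub]
      abel)
    (fun y z m => by
      obtain ⟨a, rfl⟩ := hq_surj m
      rw [hbr, hr, hr, hr, hr, hl, ← map_add, hq]
      convert B.neg_mem (hAB a a.2 _ (hσ y z)) using 1
      simp only [Submodule.coe_add, hL a, mul_sub]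
      abel)
    c
    (fun x y z => by
      simp only [hbr, hcq, hl, hr, ← map_add]
      rw [hq]
      convert B.zero_mem
      simp only [Submodule.coe_add, mul_sub, sub_mul, hL (σ x) (σ y), leibniz_lie x y z, map_add]
      abel)
  obtain ⟨s, hs⟩ := q.exists_rightInverse_of_surjective (LinearMap.range_eq_top.2 hq_surj)
  refine ⟨A.subtype ∘ₗ s ∘ₗ h, fun x => (s (h x)).2, fun x y => ?_⟩
  have hqs (x : g) : h x = q (s (h x)) := (LinearMap.congr_fun hs (h x)).symm
  have hxy := hh x y
  rw [hqs x, hqs y, hqs ⁅x, y⁆, hbr, hcq, hl, hr, ← map_add, ← map_sub, hq] at hxy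
  -- The linear part in `h` cancels the cocycle modulo `B`; the quadratic term `h x * h y` is a
  -- product within `A`.
  convert B.add_mem hxy (hAB _ (s (h x)).2 _ (s (h y)).2) using 1
  simp only [Submodule.coe_add, Submodule.coe_sub, LinearMap.sub_apply, LinearMap.comp_apply,
    Submodule.subtype_apply, mul_sub, sub_mul]
  abel

end Lifting

universe u

/-! ### Splitting off the radical -/

section LeviDecomposition

variable {k L : Type*} [Field k] [NonUnitalNonAssocRing L] [Module k L] [IsScalarTower k L L]
  [SMulCommClass k L L]

theorem IsIdeal.map₂_mul (hL : IsLeftLeibniz L) {I : Submodule k L} (hI : IsIdeal I) :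
    IsIdeal (Submodule.map₂ (LinearMap.mul k L) I I) := by
  intro x y hy
  have hmem (a b : L) (ha : a ∈ I) (hb : b ∈ I) :
      a * b ∈ Submodule.map₂ (LinearMap.mul k L) I I := Submodule.apply_mem_map₂ _ ha hb
  rw [Submodule.map₂_eq_span_image2] at hy
  induction hy using Submodule.span_induction with
  | mem y hy =>
    obtain ⟨a, ha, b, hb, rfl⟩ := hy
    refine ⟨?_, ?_⟩
    · change x * (a * b) ∈ _
      rw [hL]
      exact add_mem (hmem _ _ (hI x a ha).1 hb) (hmem _ _ ha (hI x b hb).1)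
    · change a * b * x ∈ _
      rw [← sub_eq_of_eq_add (hL a b x)]
      exact sub_mem (hmem _ _ ha (hI x b hb).2) (hmem _ _ hb (hI x a ha).2)
  | zero => simp
  | add a b _ _ ha hb =>
    rw [mul_add, add_mul]
    exact ⟨add_mem ha.1 hb.1, add_mem ha.2 hb.2⟩
  | smul t a _ ha =>
    rw [mul_smul_comm, smul_mul_assoc]
    exact ⟨Submodule.smul_mem _ t ha.1, Submodule.smul_mem _ t ha.2⟩

theorem IsIdeal.derivedSeries (hL : IsLeftLeibniz L) {I : Submodule k L} (hI : IsIdeal I) (n : ℕ) :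
    IsIdeal (derivedSeries I n) := by
  induction n with
  | zero => exact hI
  | succ n ih => exact ih.map₂_mul hL

/-- A surjection with solvable kernel onto a semisimple Lie algebra splits. -/
theorem exists_multiplicative_section [CharZero k] [FiniteDimensional k L]
    {g : Type*} [LieRing g] [LieAlgebra k g] [FiniteDimensional k g] [IsKilling k g]
    (hL : IsLeftLeibniz L) (f : L →ₗ[k] g) (hf : Function.Surjective f)
    (hmul : ∀ x y, f (x * y) = ⁅f x, f y⁆) (hid : IsIdeal (LinearMap.ker f))
    (hsol : IsSolvable (LinearMap.ker f)) :
    ∃ σ : g →ₗ[k] L, (∀ x, f (σ x) = x) ∧ ∀ x y, σ ⁅x, y⁆ = σ x * σ y := by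
  have key (n : ℕ) : ∃ σ : g →ₗ[k] L, (∀ x, f (σ x) = x) ∧
      ∀ x y, σ x * σ y - σ ⁅x, y⁆ ∈ derivedSeries (LinearMap.ker f) n := by
    induction n with
    | zero =>
      obtain ⟨σ, hσ⟩ := f.exists_rightInverse_of_surjective (LinearMap.range_eq_top.2 hf)
      have hσ' (x : g) : f (σ x) = x := LinearMap.congr_fun hσ x
      refine ⟨σ, hσ', fun x y => ?_⟩
      change f _ = 0
      rw [map_sub, hmul, hσ', hσ', hσ', sub_self]
    | succ n ih =>
      obtain ⟨σ, hσ, hσ'⟩ := ih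
      obtain ⟨h, hh, hh'⟩ := exists_correction hL (hid.derivedSeries hL n)
        (hid.derivedSeries hL (n + 1)) (fun a ha b hb => Submodule.apply_mem_map₂ _ ha hb) σ hσ'
      refine ⟨σ - h, fun x => ?_, hh'⟩
      -- The correction takes values in `ker f`, so `σ - h` is still a section.
      have hle : derivedSeries (LinearMap.ker f) n ≤ LinearMap.ker f := by
        clear * - hid
        induction n with
        | zero => exact le_rfl
        | succ n ih =>
          exact Submodule.map₂_le.2 fun a ha b hb => (hid a b (ih hb)).1
      rw [LinearMap.sub_apply, map_sub, hσ, show f (h x) = 0 from hle (hh x), sub_zero]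
  obtain ⟨n, hn⟩ := hsol
  obtain ⟨σ, hσ, hσ'⟩ := key n
  refine ⟨σ, hσ, fun x y => ?_⟩
  have := hσ' x y
  rw [hn, Submodule.mem_bot, sub_eq_zero] at this
  exact this.symm

/-- The Leibniz identity with two equal arguments gives `(x * x) * z = 0`, so the span of the
squares multiplies to zero from the left. It is a left ideal because `y * (x * x)` is the polarised
square of `x` and `y * x`. -/
theorem mul_self_mem_radical (hL : IsLeftLeibniz L) (x : L) : x * x ∈ radical k L := by
  have hz (x z : L) : x * x * z = 0 := by
    have := hL x x z
    rwa [right_eq_add] at this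
  let J : Submodule k L := Submodule.span k (Set.range fun x : L => x * x)
  have hJ (a b : L) (ha : a ∈ J) : a * b = 0 := by
    induction ha using Submodule.span_induction with
    | mem a ha => obtain ⟨x, rfl⟩ := ha; exact hz x b
    | zero => simp
    | add a c _ _ ha hc => rw [add_mul, ha, hc, add_zero]
    | smul t a _ ha => rw [smul_mul_assoc, ha, smul_zero]
  have hsq (x : L) : x * x ∈ J := Submodule.subset_span ⟨x, rfl⟩
  refine le_sSup (show J ∈ {I : Submodule k L | IsIdeal I ∧ IsSolvable I} from
    ⟨fun y a ha => ⟨?_, ?_⟩, 1, ?_⟩) (hsq x)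
  · induction ha using Submodule.span_induction with
    | mem a ha =>
      obtain ⟨x, rfl⟩ := ha
      have h : y * (x * x) = (x + y * x) * (x + y * x) - x * x - y * x * (y * x) := by
        rw [hL y x x]
        simp only [add_mul, mul_add]
        abel
      change y * (x * x) ∈ J
      rw [h]
      exact sub_mem (sub_mem (hsq _) (hsq _)) (hsq _)
    | zero => simp
    | add a c _ _ ha hc => rw [mul_add]; exact add_mem ha hc
    | smul t a _ ha => rw [mul_smul_comm]; exact Submodule.smul_mem _ t ha
  · rw [hJ a y ha]
    exact zero_mem _
  · rw [eq_bot_iff]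
    refine Submodule.map₂_le.2 fun a ha b _ => ?_
    rw [LinearMap.mul_apply', hJ a b ha]
    exact zero_mem _

/-- The multiplication induced on the quotient by an ideal. -/
def IsIdeal.quotientMul {I : Submodule k L} (hI : IsIdeal I) : L ⧸ I →ₗ[k] L ⧸ I →ₗ[k] L ⧸ I :=
  I.liftQ
    { toFun x := I.mapQ I (LinearMap.mul k L x) fun y hy => (hI x y hy).1
      map_add' x y := by ext z; simp; rfl
      map_smul' t x := by ext z; simp; rfl }
    fun x hx => by
      ext z
      exact (Submodule.Quotient.mk_eq_zero I).2 (hI z x hx).2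

theorem IsIdeal.quotientMul_mk {I : Submodule k L} (hI : IsIdeal I) (x y : L) :
    hI.quotientMul (I.mkQ x) (I.mkQ y) = I.mkQ (x * y) := rfl

/-- The Lie ring structure on the quotient of a Leibniz algebra by an ideal that contains all
squares. -/
abbrev IsIdeal.quotientLieRing {I : Submodule k L} (hI : IsIdeal I) (hL : IsLeftLeibniz L)
    (hsq : ∀ x : L, x * x ∈ I) : LieRing (L ⧸ I) where
  bracket x y := hI.quotientMul x y
  add_lie x y z := by simp only [map_add, LinearMap.add_apply]
  lie_add x y z := map_add _ y z
  lie_self x := by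
    obtain ⟨x, rfl⟩ := I.mkQ_surjective x
    exact (Submodule.Quotient.mk_eq_zero I).2 (hsq x)
  leibniz_lie x y z := by
    obtain ⟨x, rfl⟩ := I.mkQ_surjective x
    obtain ⟨y, rfl⟩ := I.mkQ_surjective y
    obtain ⟨z, rfl⟩ := I.mkQ_surjective z
    simp only [IsIdeal.quotientMul_mk, hL x y z, map_add]

/-- The Lie algebra structure on the quotient of a Leibniz algebra by an ideal that contains all
squares. -/
abbrev IsIdeal.quotientLieAlgebra {I : Submodule k L} (hI : IsIdeal I) (hL : IsLeftLeibniz L)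
    (hsq : ∀ x : L, x * x ∈ I) :
    letI := hI.quotientLieRing hL hsq
    LieAlgebra k (L ⧸ I) :=
  letI := hI.quotientLieRing hL hsq
  { lie_smul := fun t x y => map_smul (hI.quotientMul x) t y }

/-- Some semisimple Lie algebra embeds into a left Leibniz algebra as a complement to the
radical. -/
theorem exists_levi_embedding {k : Type*} {L : Type u} [Field k] [CharZero k]
    [NonUnitalNonAssocRing L] [Module k L] [IsScalarTower k L L] [SMulCommClass k L L]
    [FiniteDimensional k L] (hL : IsLeftLeibniz L) :
    ∃ (g : Type u) (_ : LieRing g) (_ : LieAlgebra k g) (_ : FiniteDimensional k g)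
      (_ : IsKilling k g) (σ : g →ₗ[k] L),
      Function.Injective σ ∧ (∀ x y, σ ⁅x, y⁆ = σ x * σ y) ∧
        LinearMap.range σ ⊔ radical k L = ⊤ := by
  obtain ⟨⟨hid, hsol⟩, hmax⟩ := isGreatest_radical k L
  set R := radical k L
  have hsq (x : L) : x * x ∈ R := mul_self_mem_radical hL x
  let hring := hid.quotientLieRing hL hsq
  let halg := hid.quotientLieAlgebra hL hsq
  have hbr (x y : L) : (⁅R.mkQ x, R.mkQ y⁆ : L ⧸ R) = R.mkQ (x * y) := rfl
  have hrad : HasTrivialRadical k (L ⧸ R) := by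
    rw [hasTrivialRadical_iff_no_abelian_ideals]
    intro J hJ
    -- The preimage of an abelian ideal has its products in `R`: one derived step reaches `R`, and
    -- `n` more reach zero.
    have hJR : J.toSubmodule.comap R.mkQ ≤ R := by
      refine hmax ⟨fun x y hy => ⟨?_, ?_⟩, ?_⟩
      · exact lie_mem_right k (L ⧸ R) J (R.mkQ x) (R.mkQ y) hy
      · exact lie_mem_left k (L ⧸ R) J (R.mkQ y) (R.mkQ x) hy
      · obtain ⟨n, hn⟩ := hsol
        refine ⟨1 + n, ?_⟩
        rw [derivedSeries_add, eq_bot_iff, ← hn]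
        refine derivedSeries_mono (Submodule.map₂_le.2 fun x hx y hy => ?_) n
        have h : ⁅(⟨R.mkQ x, hx⟩ : J), (⟨R.mkQ y, hy⟩ : J)⁆ = 0 := trivial_lie_zero J J _ _
        exact (Submodule.Quotient.mk_eq_zero R).1 (congrArg Subtype.val h)
    rw [LieSubmodule.eq_bot_iff]
    intro x hx
    obtain ⟨x, rfl⟩ := R.mkQ_surjective x
    exact (Submodule.Quotient.mk_eq_zero R).2 (hJR hx)
  have hker : LinearMap.ker R.mkQ = R := R.ker_mkQ
  obtain ⟨σ, hσ, hσ'⟩ := exists_multiplicative_section hL R.mkQ R.mkQ_surjective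
    (fun x y => (hbr x y).symm) (by rwa [hker]) (by rwa [hker])
  refine ⟨L ⧸ R, hring, halg, inferInstance, inferInstance, σ, Function.LeftInverse.injective hσ, hσ', ?_⟩
  rw [eq_top_iff]
  intro x _
  refine Submodule.mem_sup.2 ⟨σ (R.mkQ x), ⟨_, rfl⟩, x - σ (R.mkQ x), ?_, add_sub_cancel _ _⟩
  exact (Submodule.Quotient.mk_eq_zero R).1 <| by
    rw [Submodule.Quotient.mk_sub, sub_eq_zero]
    exact (hσ (R.mkQ x)).symm

omit [IsScalarTower k L L] in
/-- The image of a semisimple Lie algebra under an injective multiplicative map is a semisimple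
Lie subalgebra. -/
theorem exists_semisimple_subalgebra {g : Type*} [LieRing g] [LieAlgebra k g]
    [FiniteDimensional k g] [IsKilling k g] (σ : g →ₗ[k] L) (hinj : Function.Injective σ)
    (hmul : ∀ x y, σ ⁅x, y⁆ = σ x * σ y) :
    ∃ S : NonUnitalSubalgebra k L, IsSemisimpleLie k S ∧ S.toSubmodule = LinearMap.range σ := by
  let S : NonUnitalSubalgebra k L :=
    { LinearMap.range σ with
      mul_mem' := by
        rintro _ _ ⟨x, rfl⟩ ⟨y, rfl⟩
        exact ⟨⁅x, y⁆, hmul x y⟩ }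
  have hS : IsLie S := by
    constructor
    · rintro ⟨_, x, rfl⟩
      apply Subtype.ext
      change σ x * σ x = 0
      rw [← hmul, lie_self, map_zero]
    · rintro ⟨_, x, rfl⟩ ⟨_, y, rfl⟩ ⟨_, z, rfl⟩
      apply Subtype.ext
      change σ x * (σ y * σ z) = σ x * σ y * σ z + σ y * (σ x * σ z)
      simp only [← hmul, ← map_add]
      rw [leibniz_lie]
  refine ⟨S, ⟨hS, ?_⟩, rfl⟩
  let := hS.lieRing
  let := hS.lieAlgebra k
  let e : g ≃ₗ⁅k⁆ S :=
    { LinearEquiv.ofInjective σ hinj with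
      map_lie' := fun {x y} => Subtype.ext (hmul x y) }
  have : IsKilling k S := isKilling_of_equiv e
  have : FiniteDimensional k S := Module.Finite.equiv e.toLinearEquiv
  infer_instance

/-! ### Passage to the opposite algebra -/

theorem derivedSeries_map_unop_le (I : Submodule k Lᵐᵒᵖ) (n : ℕ) :
    derivedSeries (I.map (MulOpposite.opLinearEquiv k).symm.toLinearMap) n ≤
      (derivedSeries I n).map (MulOpposite.opLinearEquiv k).symm.toLinearMap := by
  induction n with
  | zero => exact le_rfl
  | succ n ih =>
    refine Submodule.map₂_le.2 fun x hx y hy => ?_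
    obtain ⟨a, ha, rfl⟩ := ih hx
    obtain ⟨b, hb, rfl⟩ := ih hy
    exact ⟨b * a, Submodule.apply_mem_map₂ _ hb ha, rfl⟩

theorem map_unop_radical_le :
    (radical k Lᵐᵒᵖ).map (MulOpposite.opLinearEquiv k).symm.toLinearMap ≤ radical k L := by
  rw [Submodule.map_le_iff_le_comap]
  refine sSup_le fun I hI => ?_
  rw [← Submodule.map_le_iff_le_comap]
  refine le_sSup ⟨?_, ?_⟩
  · rintro x _ ⟨y, hy, rfl⟩
    exact ⟨⟨y * MulOpposite.op x, (hI.1 _ y hy).2, rfl⟩, ⟨MulOpposite.op x * y, (hI.1 _ y hy).1, rfl⟩⟩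
  · obtain ⟨n, hn⟩ := hI.2
    refine ⟨n, ?_⟩
    rw [eq_bot_iff]
    refine (derivedSeries_map_unop_le I n).trans ?_
    rw [hn, Submodule.map_bot]

theorem IsRightLeibniz.op (hL : IsRightLeibniz L) : IsLeftLeibniz Lᵐᵒᵖ := fun x y z =>
  MulOpposite.unop_injective <| by
    change (z.unop * y.unop) * x.unop = z.unop * (y.unop * x.unop) + (z.unop * x.unop) * y.unop
    rw [hL, add_comm]

end LeviDecomposition

end Leibniz

theorem proposition7 {k L : Type*} [Field k] [CharZero k]
    [NonUnitalNonAssocRing L] [Module k L] [IsScalarTower k L L] [SMulCommClass k L L]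
    [FiniteDimensional k L] (hL : Leibniz.IsLeibniz L) :
    ∃ S : NonUnitalSubalgebra k L,
      Leibniz.IsSemisimpleLie k S ∧ S.toSubmodule ⊔ Leibniz.radical k L = ⊤ := by
  rcases hL with hL | hL
  · obtain ⟨g, _, _, _, _, σ, hinj, hmul, htop⟩ := Leibniz.exists_levi_embedding (k := k) hL
    obtain ⟨S, hS, hSσ⟩ := Leibniz.exists_semisimple_subalgebra σ hinj hmul
    exact ⟨S, hS, by rw [hSσ, htop]⟩
  · have : FiniteDimensional k Lᵐᵒᵖ := Module.Finite.equiv (MulOpposite.opLinearEquiv k)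
    obtain ⟨g, _, _, _, _, σ, hinj, hmul, htop⟩ := Leibniz.exists_levi_embedding (k := k) hL.op
    let u : Lᵐᵒᵖ →ₗ[k] L := (MulOpposite.opLinearEquiv k).symm.toLinearMap
    -- `u` reverses products; the sign restores multiplicativity, by antisymmetry of the bracket of
    -- `g`, and does not change the range.
    obtain ⟨S, hS, hSσ⟩ := Leibniz.exists_semisimple_subalgebra (-(u ∘ₗ σ))
      (fun x y h => hinj (MulOpposite.unop_injective (neg_injective h)))
      (fun x y => by
        change -(σ ⁅x, y⁆).unop = -(σ x).unop * -(σ y).unop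
        rw [neg_mul_neg, ← MulOpposite.unop_mul, ← hmul, ← lie_skew, map_neg, MulOpposite.unop_neg,
          neg_neg])
    refine ⟨S, hS, ?_⟩
    rw [hSσ, LinearMap.range_neg, LinearMap.range_comp, eq_top_iff]
    refine le_trans ?_ (sup_le_sup_left Leibniz.map_unop_radical_le _)
    rw [← Submodule.map_sup, htop, Submodule.map_top, LinearEquiv.range]
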